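/- Theorem 1 (Geodesic interpolation and extrapolation). Let $M\subset\mathbb{R}^d$ be compact, let $\Omega$ be the set of Borel probability measures supported on $M$ that are absolutely continuous with respect to Lebesgue measure, and let $W_2$ be the 2-Wasserstein distance. A constant speed geodesic in $\Omega$ on an interval $[a,b]$, $a<b$, is a family $(\gamma(t))_{t\in[a,b]}$ in $\Omega$ with $W_2(\gamma(s),\gamma(t))=\frac{|s-t|}{b-a}\,W_2(\gamma(a),\gamma(b))$ for all $s,t\in[a,b]$; it is called unique if it is the only constant speed geodesic in $\Omega$ on $[a,b]$ with endpoints $\gamma(a)$ and $\gamma(b)$. For predictors $x_1,\dots,x_n\in\mathbb{R}^q$ and responses $\nu_1,\dots,\nu_n\in\Omega$ put $\bar x=\frac1n\sum_i x_i$ and $\Sigma=\frac1n\sum_i(x_i-\bar x)(x_i-\bar x)^{\top}$, let $\Sigma^{-}$ be the Moore–Penrose inverse of $\Sigma$ (equal to $\Sigma^{-1}$ if $\Sigma$ is invertible), and let the global Fréchet-regression estimate at $x\in\mathbb{R}^q$ be $$\hat\mu_G(x)=\operatorname*{arg\,min}_{\mu\in\Omega}\ \frac1n\sum_{i=1}^n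 s_{i}(x)\,W_2^2(\mu,\nu_i),\qquad s_{i}(x)=1+(x_i-\bar x)^{\top}\Sigma^{-}(x-\bar x).$$ Suppose that $\nu(t)$, $t\in[0,1]$, is a unique constant speed geodesic in $\Omega$, that $\nu_i=\nu(t_i)$ with $t_i\in[0,1]$, and that $x_i=t_i c+b$ for fixed vectors $b,c\in\mathbb{R}^q$, where the $x_i$ are not all equal. Then for every $u\in[0,1]$ the minimizer $\hat\mu_G(uc+b)$ exists, is unique, and equals $\nu(u)$; that is, the estimate recovers the geodesic for $x$ on the segment from $b$ to $b+c$. If moreover $s_1\le 0$, $1\le s_2$, and the geodesic extends to a constant speed geodesic $\nu(t)$, $t\in[s_1,s_2]$, in $\Omega$ that is unique on $[s_1,s_2]$, then for every $u\in[s_1,s_2]$ the minimizer $\hat\mu_G(uc+b)$ exists, is unique, and equals $\nu(u)$; here it suffices that $t_i\in[s_1,s_2]$ for all $i$. -/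

import Mathlib

open MeasureTheory Set

open scoped ENNReal Matrix

namespace FrechetRegression

noncomputable section

/-- Couplings of `μ` and `ν`: measures on the product with marginals `μ` and `ν`. -/
def couplings {d : ℕ} (μ ν : Measure (EuclideanSpace ℝ (Fin d))) :
    Set (Measure (EuclideanSpace ℝ (Fin d) × EuclideanSpace ℝ (Fin d))) :=
  {π | π.map Prod.fst = μ ∧ π.map Prod.snd = ν}

/-- The quadratic optimal transport cost, the infimum over all couplings of the integral of
`‖y - z‖²`, as an extended nonnegative real. -/
def transportCost {d : ℕ} (μ ν : Measure (EuclideanSpace ℝ (Fin d))) : ℝ≥0∞ :=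
  ⨅ π ∈ couplings μ ν, ∫⁻ p, ‖p.1 - p.2‖ₑ ^ 2 ∂π

/-- The 2-Wasserstein distance. The cost is finite for probability measures
that are supported on a compact set. -/
def W₂ {d : ℕ} (μ ν : Measure (EuclideanSpace ℝ (Fin d))) : ℝ :=
  Real.sqrt (transportCost μ ν).toReal

/-- The space `Ω` of probability measures that are supported on `M` and absolutely continuous
with respect to Lebesgue measure. -/
def acMeasures {d : ℕ} (M : Set (EuclideanSpace ℝ (Fin d))) :
    Set (Measure (EuclideanSpace ℝ (Fin d))) :=
  {μ | IsProbabilityMeasure μ ∧ μ Mᶜ = 0 ∧ μ ≪ volume}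

/-- `γ` restricted to `[a, b]` is a constant speed geodesic in `Ω`. For `a = 0`, `b = 1` this reads
`W₂ (γ s) (γ t) = |s - t| * W₂ (γ 0) (γ 1)`. -/
def IsGeodesicOn {d : ℕ} (M : Set (EuclideanSpace ℝ (Fin d)))
    (γ : ℝ → Measure (EuclideanSpace ℝ (Fin d))) (a b : ℝ) : Prop :=
  (∀ t ∈ Icc a b, γ t ∈ acMeasures M) ∧
    ∀ s ∈ Icc a b, ∀ t ∈ Icc a b, W₂ (γ s) (γ t) = |s - t| / (b - a) * W₂ (γ a) (γ b)

/-- `γ` is, on `[a, b]`, the only constant speed geodesic in `Ω` that connects `γ a` and `γ b`. -/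
def IsUniqueGeodesicOn {d : ℕ} (M : Set (EuclideanSpace ℝ (Fin d)))
    (γ : ℝ → Measure (EuclideanSpace ℝ (Fin d))) (a b : ℝ) : Prop :=
  IsGeodesicOn M γ a b ∧
    ∀ γ' : ℝ → Measure (EuclideanSpace ℝ (Fin d)), IsGeodesicOn M γ' a b →
      γ' a = γ a → γ' b = γ b → ∀ t ∈ Icc a b, γ' t = γ t

/-- The sample mean of the predictors. -/
def sampleMean {n q : ℕ} (x : Fin n → EuclideanSpace ℝ (Fin q)) : EuclideanSpace ℝ (Fin q) :=
  (n : ℝ)⁻¹ • ∑ i, x i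

/-- The empirical covariance matrix of the predictors (with factor `1 / n`). -/
def sampleCov {n q : ℕ} (x : Fin n → EuclideanSpace ℝ (Fin q)) : Matrix (Fin q) (Fin q) ℝ :=
  (n : ℝ)⁻¹ • ∑ i, Matrix.vecMulVec (x i - sampleMean x).ofLp (x i - sampleMean x).ofLp

/-- The empirical covariance matrix is symmetric. -/
theorem sampleCov_isHermitian {n q : ℕ} (x : Fin n → EuclideanSpace ℝ (Fin q)) :
    (sampleCov x).IsHermitian := by
  ext j k
  simp [sampleCov, Matrix.sum_apply, Matrix.vecMulVec_apply, mul_comm]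

/-- The Moore-Penrose inverse of a real symmetric matrix: every nonzero eigenvalue is inverted and
the kernel is kept. See `pinv_penrose` and `pinv_eq_inv` below. -/
def pinv {q : ℕ} (S : Matrix (Fin q) (Fin q) ℝ) : Matrix (Fin q) (Fin q) ℝ :=
  cfc (fun r : ℝ => r⁻¹) S

/-- The four Penrose equations, which characterize the Moore-Penrose inverse. -/
theorem pinv_penrose {q : ℕ} {S : Matrix (Fin q) (Fin q) ℝ} (hS : S.IsHermitian) :
    S * pinv S * S = S ∧ pinv S * S * pinv S = pinv S ∧
      (S * pinv S).IsHermitian ∧ (pinv S * S).IsHermitian := by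
  have hsa : IsSelfAdjoint S := hS
  have hc : ∀ f : ℝ → ℝ, ContinuousOn f (spectrum ℝ S) := fun f =>
    (Matrix.finite_real_spectrum (A := S)).continuousOn f
  have h1 : S * pinv S = cfc (fun r : ℝ => r * r⁻¹) S := by
    rw [cfc_mul (fun r : ℝ => r) (fun r => r⁻¹) S (hc _) (hc _), cfc_id' ℝ S]
    rfl
  have h2 : pinv S * S = cfc (fun r : ℝ => r * r⁻¹) S := by
    have : (fun r : ℝ => r * r⁻¹) = fun r => r⁻¹ * r := by
      funext r; ring
    rw [this, cfc_mul (fun r : ℝ => r⁻¹) (fun r => r) S (hc _) (hc _), cfc_id' ℝ S]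
    rfl
  refine ⟨?_, ?_, ?_, ?_⟩
  · rw [h1]
    nth_rewrite 2 [← cfc_id' ℝ S]
    rw [← cfc_mul _ _ S (hc _) (hc _)]
    conv_rhs => rw [← cfc_id' ℝ S]
    congr 1
    funext r
    exact mul_inv_mul_cancel r
  · rw [h2]
    unfold pinv
    rw [← cfc_mul _ _ S (hc _) (hc _)]
    congr 1
    funext r
    by_cases h : r = 0
    · simp [h]
    · field_simp
  · rw [h1]
    exact cfc_predicate (fun r : ℝ => r * r⁻¹) S
  · rw [h2]
    exact cfc_predicate (fun r : ℝ => r * r⁻¹) S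

/-- For an invertible symmetric matrix the Moore-Penrose inverse is the ordinary inverse. -/
theorem pinv_eq_inv {q : ℕ} {S : Matrix (Fin q) (Fin q) ℝ} (hS : S.IsHermitian)
    (hu : IsUnit S.det) : pinv S = S⁻¹ := by
  have h := (pinv_penrose hS).1
  have h' : S⁻¹ * (S * pinv S * S) * S⁻¹ = S⁻¹ * S * S⁻¹ := by rw [h]
  rw [Matrix.mul_assoc S, Matrix.nonsing_inv_mul_cancel_left _ _ hu,
    Matrix.mul_nonsing_inv_cancel_right _ _ hu, Matrix.nonsing_inv_mul _ hu, Matrix.one_mul] at h'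
  exact h'

/-- The weights `1 + (xᵢ - x̄)ᵀ Σ⁻ (y - x̄)` of the global model at the predictor value `y`. -/
def globalWeight {n q : ℕ} (x : Fin n → EuclideanSpace ℝ (Fin q)) (i : Fin n)
    (y : EuclideanSpace ℝ (Fin q)) : ℝ :=
  1 + (x i - sampleMean x).ofLp ⬝ᵥ (pinv (sampleCov x) *ᵥ (y - sampleMean x).ofLp)

/-- The objective function of global Fréchet regression at the predictor value `y`. -/
def globalObjective {n d q : ℕ} (x : Fin n → EuclideanSpace ℝ (Fin q))
    (ν : Fin n → Measure (EuclideanSpace ℝ (Fin d))) (y : EuclideanSpace ℝ (Fin q))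
    (μ : Measure (EuclideanSpace ℝ (Fin d))) : ℝ :=
  (n : ℝ)⁻¹ * ∑ i, globalWeight x i y * W₂ μ (ν i) ^ 2

/-- The global Fréchet regression estimate at the predictor value `y`, as the set of all minimizers
over `Ω` of the objective function. -/
def globalEstimate {n d q : ℕ} (M : Set (EuclideanSpace ℝ (Fin d)))
    (x : Fin n → EuclideanSpace ℝ (Fin q)) (ν : Fin n → Measure (EuclideanSpace ℝ (Fin d)))
    (y : EuclideanSpace ℝ (Fin q)) : Set (Measure (EuclideanSpace ℝ (Fin d))) :=
  {μ | μ ∈ acMeasures M ∧ ∀ μ' ∈ acMeasures M, globalObjective x ν y μ ≤ globalObjective x ν y μ'}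

end

end FrechetRegression

open FrechetRegression

/-! For collinear predictors the weights divided by n are an affine function w of the parameters,
with ∑ w(t_i) = 1 and ∑ w(t_i) t_i = u (`globalWeight_of_collinear`). The Wasserstein space is
nonnegatively curved (`W₂_sq_comparison`), so along a geodesic of speed λ the function k(s) = W₂(μ,
γ s)² - λ²(s - u)² is concave (`concaveOn_W₂_sq_sub`). The weighted sum of k is exactly the
objective at μ minus the objective at γ u.

Weights of both signs rule out a termwise bound, but because w is affine the sum is still at least
the chord of k between the endpoints, evaluated at u (`chord_le_sum_of_concaveOn`). Only the two
endpoints remain: the triangle inequality makes the chord nonnegative, and it vanishes only if μ has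
the same distances to γ a and γ b as γ u.

Such a μ equals γ u because γ a is absolutely continuous (`eq_of_intermediate`): the average of two
intermediate points is again intermediate, so the average of their optimal couplings is optimal, and
its monotone support is single-valued off a Lebesgue null set. The argument works on every interval
[a, b], so interpolation and extrapolation are the same case. -/

namespace FrechetRegression

open ProbabilityTheory Filter Topology

variable {d : ℕ}

/-! ### Gluing and existence of optimal couplings -/

/-- Three measures with the same first marginal can be glued along it. -/
theorem exists_gluing {α β : Type*} [MeasurableSpace α] [MeasurableSpace β]
    [StandardBorelSpace β] [Nonempty β] {μ : Measure α} [IsProbabilityMeasure μ]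
    {π₀ π₁ π₂ : Measure (α × β)} (h₀ : π₀.map Prod.fst = μ) (h₁ : π₁.map Prod.fst = μ)
    (h₂ : π₂.map Prod.fst = μ) :
    ∃ P : Measure (α × β × β × β), IsProbabilityMeasure P ∧
      P.map (fun p => (p.1, p.2.1)) = π₀ ∧ P.map (fun p => (p.1, p.2.2.1)) = π₁ ∧
      P.map (fun p => (p.1, p.2.2.2)) = π₂ := by
  have hp : ∀ π : Measure (α × β), π.map Prod.fst = μ → IsProbabilityMeasure π := fun π h => by
    constructor
    have := measure_univ (μ := μ)
    rwa [← h, Measure.map_apply measurable_fst MeasurableSet.univ] at this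
  have := hp _ h₀
  have := hp _ h₁
  have := hp _ h₂
  -- Given the common coordinate, the other three are drawn independently from the disintegrations.
  refine ⟨μ ⊗ₘ (π₀.condKernel ×ₖ (π₁.condKernel ×ₖ π₂.condKernel)), inferInstance, ?_, ?_, ?_⟩
  · have h : (π₀.condKernel ×ₖ (π₁.condKernel ×ₖ π₂.condKernel)).map Prod.fst = π₀.condKernel := by
      rw [← Kernel.fst_eq, Kernel.fst_prod]
    have h' := Measure.compProd_map (μ := μ)
      (κ := π₀.condKernel ×ₖ (π₁.condKernel ×ₖ π₂.condKernel)) (measurable_fst (α := β))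
    rw [h, ← h₀] at h'
    rw [← h₀]
    exact h'.symm.trans (π₀.disintegrate _)
  · have h : (π₀.condKernel ×ₖ (π₁.condKernel ×ₖ π₂.condKernel)).map (fun p => p.2.1)
        = π₁.condKernel := by
      rw [show (fun p : β × β × β => p.2.1) = Prod.fst ∘ Prod.snd from rfl,
        Kernel.map_comp_right _ measurable_snd measurable_fst, ← Kernel.snd_eq, Kernel.snd_prod,
        ← Kernel.fst_eq, Kernel.fst_prod]
    have h' := Measure.compProd_map (μ := μ)
      (κ := π₀.condKernel ×ₖ (π₁.condKernel ×ₖ π₂.condKernel))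
      (f := fun p : β × β × β => p.2.1) (by fun_prop)
    rw [h, ← h₁] at h'
    rw [← h₁]
    exact h'.symm.trans (π₁.disintegrate _)
  · have h : (π₀.condKernel ×ₖ (π₁.condKernel ×ₖ π₂.condKernel)).map (fun p => p.2.2)
        = π₂.condKernel := by
      rw [show (fun p : β × β × β => p.2.2) = Prod.snd ∘ Prod.snd from rfl,
        Kernel.map_comp_right _ measurable_snd measurable_snd,
        ← Kernel.snd_eq (_ ×ₖ _), Kernel.snd_prod, ← Kernel.snd_eq, Kernel.snd_prod]
    have h' := Measure.compProd_map (μ := μ)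
      (κ := π₀.condKernel ×ₖ (π₁.condKernel ×ₖ π₂.condKernel))
      (f := fun p : β × β × β => p.2.2) (by fun_prop)
    rw [h, ← h₂] at h'
    rw [← h₂]
    exact h'.symm.trans (π₂.disintegrate _)

/-- A random vector with values in a compact set is square integrable. -/
theorem memLp_two_of_map_compl_eq_zero {Ω : Type*} [MeasurableSpace Ω] {P : Measure Ω}
    [IsFiniteMeasure P] {M : Set (EuclideanSpace ℝ (Fin d))} (hM : IsCompact M)
    {X : Ω → EuclideanSpace ℝ (Fin d)} (hX : Measurable X) (h : P.map X Mᶜ = 0) :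
    MemLp X 2 P := by
  obtain ⟨C, hC⟩ := hM.isBounded.exists_norm_le
  refine MemLp.of_bound hX.aestronglyMeasurable C ?_
  rw [Measure.map_apply hX hM.measurableSet.compl] at h
  filter_upwards [measure_eq_zero_iff_ae_notMem.1 h] with ω hω
  exact hC _ (by simpa using hω)

theorem integrable_norm_sub_sq {Ω : Type*} [MeasurableSpace Ω] {P : Measure Ω}
    {X Y : Ω → EuclideanSpace ℝ (Fin d)} (hX : MemLp X 2 P) (hY : MemLp Y 2 P) :
    Integrable (fun ω => ‖X ω - Y ω‖ ^ 2) P :=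
  (hX.sub hY).integrable_norm_pow two_ne_zero

theorem lintegral_enorm_sub_sq {Ω : Type*} [MeasurableSpace Ω] {P : Measure Ω}
    {X Y : Ω → EuclideanSpace ℝ (Fin d)} (hX : MemLp X 2 P) (hY : MemLp Y 2 P) :
    ∫⁻ ω, ‖X ω - Y ω‖ₑ ^ 2 ∂P = ENNReal.ofReal (∫ ω, ‖X ω - Y ω‖ ^ 2 ∂P) := by
  rw [ofReal_integral_eq_lintegral_ofReal (integrable_norm_sub_sq hX hY)
    (Eventually.of_forall fun ω => by positivity)]
  refine lintegral_congr fun ω => ?_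
  rw [ENNReal.ofReal_pow (norm_nonneg _), ofReal_norm]

theorem W₂_nonneg (μ ν : Measure (EuclideanSpace ℝ (Fin d))) : 0 ≤ W₂ μ ν := Real.sqrt_nonneg _

theorem W₂_sq (μ ν : Measure (EuclideanSpace ℝ (Fin d))) :
    W₂ μ ν ^ 2 = (transportCost μ ν).toReal := Real.sq_sqrt ENNReal.toReal_nonneg

/-- The Wasserstein distance is at most the mean square distance of any two random vectors
with the given laws. -/
theorem W₂_sq_le {Ω : Type*} [MeasurableSpace Ω] {P : Measure Ω}
    {μ ν : Measure (EuclideanSpace ℝ (Fin d))}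
    {X Y : Ω → EuclideanSpace ℝ (Fin d)} (hX : Measurable X) (hY : Measurable Y)
    (hX' : MemLp X 2 P) (hY' : MemLp Y 2 P) (hμ : P.map X = μ) (hν : P.map Y = ν) :
    W₂ μ ν ^ 2 ≤ ∫ ω, ‖X ω - Y ω‖ ^ 2 ∂P := by
  rw [W₂_sq]
  refine ENNReal.toReal_le_of_le_ofReal (integral_nonneg fun ω => by positivity) ?_
  rw [← lintegral_enorm_sub_sq hX' hY']
  have hXY : Measurable fun ω => (X ω, Y ω) := hX.prodMk hY
  have hc : P.map (fun ω => (X ω, Y ω)) ∈ couplings μ ν :=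
    ⟨by rw [Measure.map_map measurable_fst hXY]; exact hμ,
      by rw [Measure.map_map measurable_snd hXY]; exact hν⟩
  refine (iInf₂_le _ hc).trans ?_
  rw [lintegral_map (by fun_prop) hXY]

/-- Optimal couplings exist. -/
theorem exists_optimal_coupling {M : Set (EuclideanSpace ℝ (Fin d))} (hM : IsCompact M)
    {μ ν : Measure (EuclideanSpace ℝ (Fin d))} (hμ : IsProbabilityMeasure μ) (hμM : μ Mᶜ = 0)
    (hν : IsProbabilityMeasure ν) (hνM : ν Mᶜ = 0) :
    ∃ π ∈ couplings μ ν, ∫ p, ‖p.1 - p.2‖ ^ 2 ∂π = W₂ μ ν ^ 2 := by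
  let E := EuclideanSpace ℝ (Fin d)
  let S : Set (ProbabilityMeasure (E × E)) := {π | (π : Measure (E × E)) ∈ couplings μ ν}
  have hne : (⟨μ.prod ν, inferInstance⟩ : ProbabilityMeasure (E × E)) ∈ S := by
    change μ.prod ν ∈ couplings μ ν
    exact ⟨by simp, by simp⟩
  have hclosed : IsClosed S := by
    have h1 : IsClosed {π : ProbabilityMeasure (E × E) |
        π.map measurable_fst.aemeasurable = ⟨μ, hμ⟩} :=
      isClosed_eq (ProbabilityMeasure.continuous_map continuous_fst) continuous_const
    have h2 : IsClosed {π : ProbabilityMeasure (E × E) |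
        π.map measurable_snd.aemeasurable = ⟨ν, hν⟩} :=
      isClosed_eq (ProbabilityMeasure.continuous_map continuous_snd) continuous_const
    convert h1.inter h2 using 1
    ext π
    exact and_congr (Subtype.ext_iff (a1 := π.map measurable_fst.aemeasurable)
      (a2 := ⟨μ, hμ⟩)).symm (Subtype.ext_iff (a1 := π.map measurable_snd.aemeasurable)
      (a2 := ⟨ν, hν⟩)).symm
  -- Tightness of the two fixed marginals gives tightness of all couplings; Prokhorov then gives
  -- compactness.
  have htight : IsTightMeasureSet {((π : ProbabilityMeasure (E × E)) : Measure (E × E)) | π ∈ S} := by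
    refine IsTightMeasureSet.prodMk ((isTightMeasureSet_singleton (μ := μ)).subset ?_)
      ((isTightMeasureSet_singleton (μ := ν)).subset ?_)
    · rintro _ ⟨_, ⟨π, hπ, rfl⟩, rfl⟩
      exact hπ.1
    · rintro _ ⟨_, ⟨π, hπ, rfl⟩, rfl⟩
      exact hπ.2
  have hcomp : IsCompact S := by
    have := isCompact_closure_of_isTightMeasureSet htight
    rwa [hclosed.closure_eq] at this
  obtain ⟨C, hC⟩ := hM.isBounded.exists_norm_le
  -- Weak continuity needs a bounded cost. Truncation at (2C)² changes nothing on M × M, where every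
  -- coupling lives.
  let f : BoundedContinuousFunction (E × E) ℝ :=
    BoundedContinuousFunction.ofNormedAddCommGroup (fun p => min (‖p.1 - p.2‖ ^ 2) ((C + C) ^ 2))
      (by fun_prop) ((C + C) ^ 2) (fun p => by
        rw [Real.norm_of_nonneg (by positivity)]; exact min_le_right _ _)
  have hmem : ∀ π ∈ couplings μ ν, IsProbabilityMeasure π ∧
      MemLp (fun p : E × E => p.1) 2 π ∧ MemLp (fun p : E × E => p.2) 2 π ∧
      ∫ p, ‖p.1 - p.2‖ ^ 2 ∂π = ∫ p, f p ∂π := by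
    rintro π ⟨h1, h2⟩
    have hp : IsProbabilityMeasure π := by
      constructor
      have := measure_univ (μ := μ)
      rwa [← h1, Measure.map_apply measurable_fst MeasurableSet.univ] at this
    refine ⟨hp, memLp_two_of_map_compl_eq_zero hM measurable_fst (h1 ▸ hμM),
      memLp_two_of_map_compl_eq_zero hM measurable_snd (h2 ▸ hνM), ?_⟩
    have h1' := hμM
    have h2' := hνM
    rw [← h1, Measure.map_apply measurable_fst hM.measurableSet.compl] at h1'
    rw [← h2, Measure.map_apply measurable_snd hM.measurableSet.compl] at h2'
    refine integral_congr_ae ?_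
    filter_upwards [measure_eq_zero_iff_ae_notMem.1 h1', measure_eq_zero_iff_ae_notMem.1 h2']
      with p hp1 hp2
    have hle : ‖p.1 - p.2‖ ≤ C + C := (norm_sub_le _ _).trans
      (add_le_add (hC _ (by simpa using hp1)) (hC _ (by simpa using hp2)))
    exact (min_eq_left (pow_le_pow_left₀ (norm_nonneg _) hle 2)).symm
  obtain ⟨π, hπS, hmin⟩ := hcomp.exists_isMinOn ⟨_, hne⟩
    (ProbabilityMeasure.continuous_integral_boundedContinuousFunction f).continuousOn
  refine ⟨π, hπS, ?_⟩
  obtain ⟨-, hπ1, hπ2, hπf⟩ := hmem π hπS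
  have hcost : transportCost μ ν = ENNReal.ofReal (∫ p, ‖p.1 - p.2‖ ^ 2 ∂(π : Measure (E × E))) := by
    apply le_antisymm
    · refine (iInf₂_le (π : Measure (E × E)) hπS).trans ?_
      rw [← lintegral_enorm_sub_sq hπ1 hπ2]
    · refine le_iInf₂ fun ρ hρ => ?_
      obtain ⟨hρp, hρ1, hρ2, hρf⟩ := hmem ρ hρ
      rw [lintegral_enorm_sub_sq hρ1 hρ2]
      refine ENNReal.ofReal_le_ofReal ?_
      rw [hπf, hρf]
      exact isMinOn_iff.1 hmin ⟨ρ, hρp⟩ hρ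
  rw [W₂_sq, hcost, ENNReal.toReal_ofReal (integral_nonneg fun ω => by positivity)]

/-! ### Metric properties and curvature of the Wasserstein space -/

/-- The probability measures that are supported on `M`. -/
def probMeasures (M : Set (EuclideanSpace ℝ (Fin d))) : Set (Measure (EuclideanSpace ℝ (Fin d))) :=
  {μ | IsProbabilityMeasure μ ∧ μ Mᶜ = 0}

theorem acMeasures_subset_probMeasures (M : Set (EuclideanSpace ℝ (Fin d))) :
    acMeasures M ⊆ probMeasures M := fun _ h => ⟨h.1, h.2.1⟩

variable {M : Set (EuclideanSpace ℝ (Fin d))}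
  {μ ν μ₀ μ₁ ν₀ ν₁ : Measure (EuclideanSpace ℝ (Fin d))}

theorem isProbabilityMeasure_of_mem_couplings
    {π : Measure (EuclideanSpace ℝ (Fin d) × EuclideanSpace ℝ (Fin d))}
    (hμ : IsProbabilityMeasure μ) (hπ : π ∈ couplings μ ν) : IsProbabilityMeasure π := by
  constructor
  have := measure_univ (μ := μ)
  rwa [← hπ.1, Measure.map_apply measurable_fst MeasurableSet.univ] at this

theorem memLp_two_of_map_mem {Ω : Type*} [MeasurableSpace Ω] {P : Measure Ω}
    [IsFiniteMeasure P] (hM : IsCompact M) (hμ : μ ∈ probMeasures M)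
    {X : Ω → EuclideanSpace ℝ (Fin d)} (hX : Measurable X) (h : P.map X = μ) : MemLp X 2 P :=
  memLp_two_of_map_compl_eq_zero hM hX (h ▸ hμ.2)

theorem W₂_comm (hM : IsCompact M) (hμ : μ ∈ probMeasures M) (hν : ν ∈ probMeasures M) :
    W₂ μ ν = W₂ ν μ := by
  have key : ∀ {μ ν : Measure (EuclideanSpace ℝ (Fin d))}, μ ∈ probMeasures M →
      ν ∈ probMeasures M → W₂ ν μ ≤ W₂ μ ν := by
    intro μ ν hμ hν
    obtain ⟨π, hπ, hopt⟩ := exists_optimal_coupling hM hμ.1 hμ.2 hν.1 hν.2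
    have := isProbabilityMeasure_of_mem_couplings hμ.1 hπ
    refine (sq_le_sq₀ (W₂_nonneg _ _) (W₂_nonneg _ _)).1 ?_
    refine (W₂_sq_le measurable_snd measurable_fst (memLp_two_of_map_mem hM hν measurable_snd hπ.2)
      (memLp_two_of_map_mem hM hμ measurable_fst hπ.1) hπ.2 hπ.1).trans_eq ?_
    rw [← hopt]
    exact integral_congr_ae (Eventually.of_forall fun p => by simp only [norm_sub_rev])
  exact le_antisymm (key hν hμ) (key hμ hν)

/-- Optimal couplings of `μ` with three other measures can be realized jointly. -/
theorem exists_joint_optimal {ν₂ : Measure (EuclideanSpace ℝ (Fin d))} (hM : IsCompact M)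
    (hμ : μ ∈ probMeasures M)
    (h₀ : ν₀ ∈ probMeasures M) (h₁ : ν₁ ∈ probMeasures M) (h₂ : ν₂ ∈ probMeasures M) :
    ∃ (Ω : Type) (_ : MeasurableSpace Ω) (P : Measure Ω)
      (X Y₀ Y₁ Y₂ : Ω → EuclideanSpace ℝ (Fin d)), IsProbabilityMeasure P ∧
      (Measurable X ∧ Measurable Y₀ ∧ Measurable Y₁ ∧ Measurable Y₂) ∧
      (P.map X = μ ∧ P.map Y₀ = ν₀ ∧ P.map Y₁ = ν₁ ∧ P.map Y₂ = ν₂) ∧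
      (MemLp X 2 P ∧ MemLp Y₀ 2 P ∧ MemLp Y₁ 2 P ∧ MemLp Y₂ 2 P) ∧
      ∫ ω, ‖X ω - Y₀ ω‖ ^ 2 ∂P = W₂ μ ν₀ ^ 2 ∧ ∫ ω, ‖X ω - Y₁ ω‖ ^ 2 ∂P = W₂ μ ν₁ ^ 2 ∧
      ∫ ω, ‖X ω - Y₂ ω‖ ^ 2 ∂P = W₂ μ ν₂ ^ 2 := by
  obtain ⟨π₀, c₀, o₀⟩ := exists_optimal_coupling hM hμ.1 hμ.2 h₀.1 h₀.2
  obtain ⟨π₁, c₁, o₁⟩ := exists_optimal_coupling hM hμ.1 hμ.2 h₁.1 h₁.2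
  obtain ⟨π₂, c₂, o₂⟩ := exists_optimal_coupling hM hμ.1 hμ.2 h₂.1 h₂.2
  have := hμ.1
  obtain ⟨P, hP, e₀, e₁, e₂⟩ := exists_gluing c₀.1 c₁.1 c₂.1
  have m₀ : Measurable fun p : EuclideanSpace ℝ (Fin d) × EuclideanSpace ℝ (Fin d) ×
    EuclideanSpace ℝ (Fin d) × EuclideanSpace ℝ (Fin d) => (p.1, p.2.1) := by fun_prop
  have m₁ : Measurable fun p : EuclideanSpace ℝ (Fin d) × EuclideanSpace ℝ (Fin d) ×
    EuclideanSpace ℝ (Fin d) × EuclideanSpace ℝ (Fin d) => (p.1, p.2.2.1) := by fun_prop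
  have m₂ : Measurable fun p : EuclideanSpace ℝ (Fin d) × EuclideanSpace ℝ (Fin d) ×
    EuclideanSpace ℝ (Fin d) × EuclideanSpace ℝ (Fin d) => (p.1, p.2.2.2) := by fun_prop
  have lX : P.map (fun p => p.1) = μ := by
    rw [← c₀.1, ← e₀, Measure.map_map measurable_fst m₀]; rfl
  have l₀ : P.map (fun p => p.2.1) = ν₀ := by
    rw [← c₀.2, ← e₀, Measure.map_map measurable_snd m₀]; rfl
  have l₁ : P.map (fun p => p.2.2.1) = ν₁ := by
    rw [← c₁.2, ← e₁, Measure.map_map measurable_snd m₁]; rfl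
  have l₂ : P.map (fun p => p.2.2.2) = ν₂ := by
    rw [← c₂.2, ← e₂, Measure.map_map measurable_snd m₂]; rfl
  refine ⟨_, _, P, fun p => p.1, fun p => p.2.1, fun p => p.2.2.1, fun p => p.2.2.2, hP,
    ⟨by fun_prop, by fun_prop, by fun_prop, by fun_prop⟩, ⟨lX, l₀, l₁, l₂⟩,
    ⟨memLp_two_of_map_mem hM hμ (by fun_prop) lX, memLp_two_of_map_mem hM h₀ (by fun_prop) l₀,
      memLp_two_of_map_mem hM h₁ (by fun_prop) l₁, memLp_two_of_map_mem hM h₂ (by fun_prop) l₂⟩,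
    ?_, ?_, ?_⟩
  · rw [← o₀, ← e₀, integral_map m₀.aemeasurable
      (Continuous.aestronglyMeasurable (by fun_prop))]
  · rw [← o₁, ← e₁, integral_map m₁.aemeasurable
      (Continuous.aestronglyMeasurable (by fun_prop))]
  · rw [← o₂, ← e₂, integral_map m₂.aemeasurable
      (Continuous.aestronglyMeasurable (by fun_prop))]

/-- Flatness of Euclidean space as an identity; integrated over glued couplings it becomes the
curvature comparison. -/
theorem norm_sub_convexCombo_sq {E : Type*} [NormedAddCommGroup E] [InnerProductSpace ℝ E]
    (l : ℝ) (y x₀ x₁ : E) :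
    ‖y - ((1 - l) • x₀ + l • x₁)‖ ^ 2 =
      (1 - l) * ‖y - x₀‖ ^ 2 + l * ‖y - x₁‖ ^ 2 - l * (1 - l) * ‖x₀ - x₁‖ ^ 2 := by
  have h0 : x₀ = y - (y - x₀) := by abel
  have h1 : x₁ = y - (y - x₁) := by abel
  generalize y - x₀ = a at *
  generalize y - x₁ = b at *
  subst h0 h1
  have e1 : y - ((1 - l) • (y - a) + l • (y - b)) = (1 - l) • a + l • b := by module
  have e2 : y - a - (y - b) = b - a := by abel
  rw [e1, e2, norm_add_sq_real, norm_sub_sq_real, norm_smul, norm_smul, inner_smul_left,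
    inner_smul_right, mul_pow, mul_pow, real_inner_comm b a]
  simp only [Real.norm_eq_abs, sq_abs, conj_trivial]
  ring

/-- The middle point μ comes first because the gluing is along the first marginal. -/
theorem W₂_triangle (hM : IsCompact M) (hμ : μ ∈ probMeasures M) (h₀ : ν₀ ∈ probMeasures M)
    (h₁ : ν₁ ∈ probMeasures M) : W₂ ν₀ ν₁ ≤ W₂ μ ν₀ + W₂ μ ν₁ := by
  obtain ⟨Ω, _, P, X, Y₀, Y₁, -, hP, ⟨mX, m₀, m₁, -⟩, ⟨lX, l₀, l₁, -⟩, ⟨sX, s₀, s₁, -⟩, o₀, o₁, -⟩ :=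
    exists_joint_optimal hM hμ h₀ h₁ h₁
  have hW := W₂_sq_le m₀ m₁ s₀ s₁ l₀ l₁
  have hA := W₂_nonneg μ ν₀
  have hB := W₂_nonneg μ ν₁
  set A := W₂ μ ν₀
  set B := W₂ μ ν₁
  have key : ∀ ε > 0, W₂ ν₀ ν₁ ≤ (A + B) + ε := by
    intro ε hε
    have hAε : 0 < A + ε / 2 := by positivity
    have hBε : 0 < B + ε / 2 := by positivity
    -- Weighted Cauchy–Schwarz replaces Minkowski's inequality; ε keeps the denominators positive
    -- when A or B is zero.
    have hpt : ∀ ω, ‖Y₀ ω - Y₁ ω‖ ^ 2 ≤ (A + B + ε) *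
        (‖X ω - Y₀ ω‖ ^ 2 / (A + ε / 2) + ‖X ω - Y₁ ω‖ ^ 2 / (B + ε / 2)) := by
      intro ω
      have h1 : ‖Y₀ ω - Y₁ ω‖ ≤ ‖X ω - Y₀ ω‖ + ‖X ω - Y₁ ω‖ := by
        rw [norm_sub_rev (X ω) (Y₀ ω)]
        exact norm_sub_le_norm_sub_add_norm_sub _ _ _
      have h2 : ‖Y₀ ω - Y₁ ω‖ ^ 2 ≤ (‖X ω - Y₀ ω‖ + ‖X ω - Y₁ ω‖) ^ 2 :=
        pow_le_pow_left₀ (norm_nonneg _) h1 2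
      refine h2.trans ?_
      rw [div_add_div _ _ hAε.ne' hBε.ne', ← mul_div_assoc, le_div_iff₀ (by positivity)]
      nlinarith [sq_nonneg ((B + ε / 2) * ‖X ω - Y₀ ω‖ - (A + ε / 2) * ‖X ω - Y₁ ω‖)]
    have hint := integral_mono (integrable_norm_sub_sq s₀ s₁)
      ((((integrable_norm_sub_sq sX s₀).div_const (A + ε / 2)).add
        ((integrable_norm_sub_sq sX s₁).div_const (B + ε / 2))).const_mul (A + B + ε)) hpt
    simp only [Pi.add_apply] at hint
    rw [integral_const_mul, integral_add ((integrable_norm_sub_sq sX s₀).div_const _)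
      ((integrable_norm_sub_sq sX s₁).div_const _), integral_div, integral_div, o₀, o₁] at hint
    have h5 : A ^ 2 / (A + ε / 2) ≤ A + ε / 2 := by
      rw [div_le_iff₀ hAε]; nlinarith
    have h6 : B ^ 2 / (B + ε / 2) ≤ B + ε / 2 := by
      rw [div_le_iff₀ hBε]; nlinarith
    have h7 : (A + B + ε) * (A ^ 2 / (A + ε / 2) + B ^ 2 / (B + ε / 2)) ≤ (A + B + ε) ^ 2 := by
      rw [sq (A + B + ε)]
      exact mul_le_mul_of_nonneg_left (by linarith) (by positivity)
    exact (sq_le_sq₀ (W₂_nonneg _ _) (by positivity)).1 (hW.trans (hint.trans h7))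
  exact le_of_forall_pos_le_add key

/-- The Wasserstein space has nonnegative curvature: the comparison inequality for a point `μ` and
an intermediate point `ν` of `ν₀` and `ν₁`. -/
theorem W₂_sq_comparison (hM : IsCompact M) (hμ : μ ∈ probMeasures M) (hν : ν ∈ probMeasures M)
    (h₀ : ν₀ ∈ probMeasures M) (h₁ : ν₁ ∈ probMeasures M) {l K : ℝ} (hl₀ : 0 ≤ l) (hl₁ : l ≤ 1)
    (hK : W₂ ν₀ ν₁ = K) (hK₀ : W₂ ν ν₀ = l * K) (hK₁ : W₂ ν ν₁ = (1 - l) * K) :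
    (1 - l) * W₂ μ ν₀ ^ 2 + l * W₂ μ ν₁ ^ 2 - l * (1 - l) * K ^ 2 ≤ W₂ μ ν ^ 2 := by
  obtain ⟨Ω, _, P, X, Y₀, Y₁, Y, hP, ⟨mX, m₀, m₁, mY⟩, ⟨lX, l₀, l₁, lY⟩, ⟨sX, s₀, s₁, sY⟩,
    o₀, o₁, oY⟩ := exists_joint_optimal hM hν h₀ h₁ hμ
  have hint : ∀ Z : Ω → EuclideanSpace ℝ (Fin d), MemLp Z 2 P →
      ∫ ω, ‖Z ω - ((1 - l) • Y₀ ω + l • Y₁ ω)‖ ^ 2 ∂P =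
        (1 - l) * ∫ ω, ‖Z ω - Y₀ ω‖ ^ 2 ∂P + l * ∫ ω, ‖Z ω - Y₁ ω‖ ^ 2 ∂P
          - l * (1 - l) * ∫ ω, ‖Y₀ ω - Y₁ ω‖ ^ 2 ∂P := by
    intro Z hZ
    simp only [norm_sub_convexCombo_sq]
    have i₀ := (integrable_norm_sub_sq hZ s₀).const_mul (1 - l)
    have i₁ := (integrable_norm_sub_sq hZ s₁).const_mul l
    have i : Integrable (fun ω => (1 - l) * ‖Z ω - Y₀ ω‖ ^ 2 + l * ‖Z ω - Y₁ ω‖ ^ 2) P := i₀.add i₁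
    rw [integral_sub i ((integrable_norm_sub_sq s₀ s₁).const_mul (l * (1 - l))),
      integral_add i₀ i₁, integral_const_mul, integral_const_mul, integral_const_mul]
  have sC : MemLp (fun ω => (1 - l) • Y₀ ω + l • Y₁ ω) 2 P :=
    (s₀.const_smul (1 - l)).add (s₁.const_smul l)
  have hX := hint X sX
  have hY := hint Y sY
  have hll : 0 ≤ l * (1 - l) := mul_nonneg hl₀ (by linarith)
  have hW := W₂_sq_le m₀ m₁ s₀ s₁ l₀ l₁
  rw [hK] at hW
  rw [o₀, o₁, hK₀, hK₁] at hX
  have hnn : 0 ≤ ∫ ω, ‖X ω - ((1 - l) • Y₀ ω + l • Y₁ ω)‖ ^ 2 ∂P :=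
    integral_nonneg fun ω => by positivity
  have hmul := mul_le_mul_of_nonneg_left hW hll
  -- The identity gives l(1-l)(K² - E‖Y₀ - Y₁‖²) ≤ 0 for this integral. Hence X is almost surely the
  -- interpolation of Y₀ and Y₁, and the identity with Y in place of X yields the claim.
  have hX0 : ∫ ω, ‖X ω - ((1 - l) • Y₀ ω + l • Y₁ ω)‖ ^ 2 ∂P = 0 := by nlinarith
  have hD : l * (1 - l) * ∫ ω, ‖Y₀ ω - Y₁ ω‖ ^ 2 ∂P = l * (1 - l) * K ^ 2 := by nlinarith
  have hae : ∀ᵐ ω ∂P, X ω = (1 - l) • Y₀ ω + l • Y₁ ω := by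
    have := (integral_eq_zero_iff_of_nonneg (fun ω => by positivity)
      (integrable_norm_sub_sq sX sC)).1 hX0
    filter_upwards [this] with ω hω
    simpa [sub_eq_zero] using hω
  have hYX : ∫ ω, ‖Y ω - ((1 - l) • Y₀ ω + l • Y₁ ω)‖ ^ 2 ∂P = W₂ μ ν ^ 2 := by
    rw [W₂_comm hM hμ hν, ← oY]
    refine integral_congr_ae ?_
    filter_upwards [hae] with ω hω
    rw [← hω, norm_sub_rev]
  rw [hYX, hD] at hY
  rw [hY]
  have b₀ := mul_le_mul_of_nonneg_left (W₂_sq_le mY m₀ sY s₀ lY l₀) (by linarith : 0 ≤ 1 - l)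
  have b₁ := mul_le_mul_of_nonneg_left (W₂_sq_le mY m₁ sY s₁ lY l₁) hl₀
  linarith

/-! ### Monotone supports and uniqueness of intermediate points -/

/-- Optimal couplings have monotone support. -/
theorem monotone_support_of_optimal (hM : IsCompact M) (hμ : μ ∈ probMeasures M)
    (hν : ν ∈ probMeasures M)
    {π : Measure (EuclideanSpace ℝ (Fin d) × EuclideanSpace ℝ (Fin d))} (hπ : π ∈ couplings μ ν)
    (hopt : ∫ p, ‖p.1 - p.2‖ ^ 2 ∂π = W₂ μ ν ^ 2) {p p' : EuclideanSpace ℝ (Fin d) ×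
      EuclideanSpace ℝ (Fin d)} (hp : p ∈ π.support) (hp' : p' ∈ π.support) :
    0 ≤ inner ℝ (p.1 - p'.1) (p.2 - p'.2) := by
  have := isProbabilityMeasure_of_mem_couplings hμ.1 hπ
  let E := EuclideanSpace ℝ (Fin d)
  let Q : Measure ((E × E) × (E × E)) := π.prod π
  let h : (E × E) × (E × E) → ℝ := fun ω => inner ℝ (ω.1.1 - ω.2.1) (ω.1.2 - ω.2.2)
  let A : Set ((E × E) × (E × E)) := {ω | h ω < 0}
  have hA : IsOpen A := isOpen_lt (by fun_prop) continuous_const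
  have hswap : Q.map Prod.swap = Q := Measure.prod_swap
  have hAswap : ∀ ω, ω.swap ∈ A ↔ ω ∈ A := by
    intro ω
    simp only [A, h, mem_ofPred_eq, Prod.fst_swap, Prod.snd_swap]
    rw [← neg_sub ω.1.1, ← neg_sub ω.1.2, inner_neg_neg]
  have hQ1 : Q.map Prod.fst = π := by simp [Q]
  have hQ2 : Q.map Prod.snd = π := by simp [Q]
  classical
  -- Two independent pairs exchange their second entries wherever monotonicity fails. As `A` is
  -- invariant under the swap, the law stays ν, so optimality forbids a gain.
  let Z : (E × E) × (E × E) → E := A.piecewise (fun ω => ω.2.2) (fun ω => ω.1.2)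
  have mZ : Measurable Z := Measurable.piecewise hA.measurableSet (by fun_prop) (by fun_prop)
  have lX : Q.map (fun ω => ω.1.1) = μ := by
    rw [← hπ.1, ← hQ1, Measure.map_map measurable_fst measurable_fst]; rfl
  have lY : Q.map (fun ω => ω.1.2) = ν := by
    rw [← hπ.2, ← hQ1, Measure.map_map measurable_snd measurable_fst]; rfl
  have lX' : Q.map (fun ω => ω.2.1) = μ := by
    rw [← hπ.1, ← hQ2, Measure.map_map measurable_fst measurable_snd]; rfl
  have lY' : Q.map (fun ω => ω.2.2) = ν := by
    rw [← hπ.2, ← hQ2, Measure.map_map measurable_snd measurable_snd]; rfl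
  have lZ : Q.map Z = ν := by
    ext B hB
    rw [Measure.map_apply mZ hB, ← measure_inter_add_sdiff _ hA.measurableSet]
    have e1 : Z ⁻¹' B ∩ A = Prod.swap ⁻¹' ((fun ω => ω.1.2) ⁻¹' B ∩ A) := by
      ext ω
      simp only [mem_inter_iff, mem_preimage, hAswap]
      refine and_congr_left fun hω => ?_
      simp [Z, hω]
    have e2 : Z ⁻¹' B \ A = (fun ω => ω.1.2) ⁻¹' B \ A := by
      ext ω
      simp only [Set.mem_sdiff, mem_preimage]
      refine and_congr_left fun hω => ?_
      simp [Z, hω]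
    have mB : MeasurableSet ((fun ω : (E × E) × (E × E) => ω.1.2) ⁻¹' B) :=
      (by fun_prop : Measurable fun ω : (E × E) × (E × E) => ω.1.2) hB
    rw [e1, e2, ← Measure.map_apply measurable_swap (mB.inter hA.measurableSet), hswap,
      measure_inter_add_sdiff _ hA.measurableSet, ← lY, Measure.map_apply (by fun_prop) hB]
  have sX : MemLp (fun ω : (E × E) × (E × E) => ω.1.1) 2 Q :=
    memLp_two_of_map_mem hM hμ (by fun_prop) lX
  have sX' : MemLp (fun ω : (E × E) × (E × E) => ω.2.1) 2 Q :=
    memLp_two_of_map_mem hM hμ (by fun_prop) lX'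
  have sY : MemLp (fun ω : (E × E) × (E × E) => ω.1.2) 2 Q :=
    memLp_two_of_map_mem hM hν (by fun_prop) lY
  have sY' : MemLp (fun ω : (E × E) × (E × E) => ω.2.2) 2 Q :=
    memLp_two_of_map_mem hM hν (by fun_prop) lY'
  have sZ : MemLp Z 2 Q := memLp_two_of_map_mem hM hν mZ lZ
  let g : (E × E) × (E × E) → ℝ := fun ω => ‖ω.1.1 - ω.2.2‖ ^ 2 - ‖ω.1.1 - ω.1.2‖ ^ 2
  have ig : Integrable g Q := (integrable_norm_sub_sq sX sY').sub (integrable_norm_sub_sq sX sY)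
  have iAg : Integrable (A.indicator g) Q := ig.indicator hA.measurableSet
  have hcost : ∫ ω, ‖ω.1.1 - Z ω‖ ^ 2 ∂Q = W₂ μ ν ^ 2 + ∫ ω, A.indicator g ω ∂Q := by
    have : ∫ ω, ‖ω.1.1 - ω.1.2‖ ^ 2 ∂Q = W₂ μ ν ^ 2 := by
      rw [← hopt]
      have := integral_map (μ := Q) (φ := Prod.fst) (f := fun p : E × E => ‖p.1 - p.2‖ ^ 2)
        measurable_fst.aemeasurable (Continuous.aestronglyMeasurable (by fun_prop))
      rw [hQ1] at this
      exact this.symm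
    rw [← this, ← integral_add (integrable_norm_sub_sq sX sY) iAg]
    refine integral_congr_ae (Eventually.of_forall fun ω => ?_)
    by_cases hω : ω ∈ A <;> simp [Z, g, hω]
  have hge : 0 ≤ ∫ ω, A.indicator g ω ∂Q := by
    have := W₂_sq_le (by fun_prop) mZ sX sZ lX lZ
    linarith
  have hsw : ∫ ω, A.indicator g ω.swap ∂Q = ∫ ω, A.indicator g ω ∂Q := by
    have := integral_map (μ := Q) (φ := Prod.swap) (f := A.indicator g)
      measurable_swap.aemeasurable (by rw [hswap]; exact iAg.aestronglyMeasurable)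
    rw [hswap] at this
    exact this.symm
  have iAg' : Integrable (fun ω => A.indicator g ω.swap) Q := by
    have : Integrable (A.indicator g) (Q.map Prod.swap) := by rwa [hswap]
    exact this.comp_measurable measurable_swap
  -- Symmetrizing over the swap turns the cost change on `A` into 2h, which is negative there; so
  -- `A` must be null.
  have hsum : ∀ ω, A.indicator g ω + A.indicator g ω.swap = - (2 * max (- h ω) 0) := by
    intro ω
    by_cases hω : ω ∈ A
    · have hω' := (hAswap ω).2 hω
      have hneg : h ω < 0 := hω
      rw [indicator_of_mem hω, indicator_of_mem hω', max_eq_left (by linarith)]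
      simp only [g, h, Prod.fst_swap, Prod.snd_swap, norm_sub_sq_real, inner_sub_left,
        inner_sub_right]
      ring
    · have hω' : ω.swap ∉ A := fun h => hω ((hAswap ω).1 h)
      have hnn : 0 ≤ h ω := not_lt.1 hω
      rw [indicator_of_notMem hω, indicator_of_notMem hω', max_eq_right (by linarith)]
      simp
  have hint : Integrable (fun ω => 2 * max (- h ω) 0) Q := by
    have := (iAg.add iAg').neg
    refine this.congr (Eventually.of_forall fun ω => ?_)
    simp only [Pi.neg_apply, Pi.add_apply]
    rw [hsum, neg_neg]
  have hzero : ∫ ω, 2 * max (- h ω) 0 ∂Q = 0 := by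
    have h1 : ∫ ω, 2 * max (- h ω) 0 ∂Q
        = - (∫ ω, A.indicator g ω ∂Q + ∫ ω, A.indicator g ω.swap ∂Q) := by
      rw [← integral_add iAg iAg', ← integral_neg]
      refine integral_congr_ae (Eventually.of_forall fun ω => ?_)
      simp only [hsum, neg_neg]
    have h2 : 0 ≤ ∫ ω, 2 * max (- h ω) 0 ∂Q := integral_nonneg fun ω => by positivity
    linarith
  have hQA : Q A = 0 := by
    have := (integral_eq_zero_iff_of_nonneg (fun ω => by positivity) hint).1 hzero
    rw [measure_eq_zero_iff_ae_notMem]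
    filter_upwards [this] with ω hω hωA
    have : h ω < 0 := hωA
    have h2 : 2 * max (- h ω) 0 = 0 := hω
    rw [max_eq_left (by linarith)] at h2
    linarith
  by_contra hneg
  have hmem : (p, p') ∈ A := not_le.1 hneg
  obtain ⟨U, hU, V, hV, hUV⟩ := mem_nhds_prod_iff.1 (hA.mem_nhds hmem)
  have hpos : 0 < Q (U ×ˢ V) := by
    rw [Measure.prod_prod]
    exact ENNReal.mul_pos ((Measure.mem_support_iff_forall p).1 hp U hU).ne'
      ((Measure.mem_support_iff_forall p').1 hp' V hV).ne'
  exact absurd (measure_mono_null hUV hQA) hpos.ne'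

/-- A set all of whose chords make a large angle with a fixed direction is Lebesgue null. -/
theorem volume_eq_zero_of_abs_inner_le {N : Set (EuclideanSpace ℝ (Fin d))}
    {e : EuclideanSpace ℝ (Fin d)} {c : ℝ} (hc₀ : 0 ≤ c) (hc : c < ‖e‖)
    (hN : ∀ x ∈ N, ∀ x' ∈ N, |inner ℝ (x - x') e| ≤ c * ‖x - x'‖) : volume N = 0 := by
  -- N need not be measurable; its closure is, and satisfies the same bound.
  have hcl : ∀ x ∈ closure N, ∀ x' ∈ closure N, |inner ℝ (x - x') e| ≤ c * ‖x - x'‖ := by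
    have hclosed : IsClosed {p : EuclideanSpace ℝ (Fin d) × EuclideanSpace ℝ (Fin d) |
        |inner ℝ (p.1 - p.2) e| ≤ c * ‖p.1 - p.2‖} := isClosed_le (by fun_prop) (by fun_prop)
    have hsub : closure (N ×ˢ N) ⊆ {p : EuclideanSpace ℝ (Fin d) × EuclideanSpace ℝ (Fin d) |
        |inner ℝ (p.1 - p.2) e| ≤ c * ‖p.1 - p.2‖} :=
      hclosed.closure_subset_iff.2 fun p hp => hN p.1 hp.1 p.2 hp.2
    rw [closure_prod_eq] at hsub
    exact fun x hx x' hx' => hsub (show (x, x') ∈ _ from ⟨hx, hx'⟩)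
  refine measure_mono_null subset_closure ?_
  -- A chord parallel to e would violate the bound, so infinitely many small translates along e are
  -- disjoint.
  refine Measure.addHaar_eq_zero_of_disjoint_translates volume
    (fun n : ℕ => (1 / ((n : ℝ) + 1)) • e) ?_ ?_ isClosed_closure.measurableSet
  · refine (Metric.isBounded_closedBall (x := (0 : EuclideanSpace ℝ (Fin d))) (r := ‖e‖)).subset ?_
    rintro _ ⟨n, rfl⟩
    rw [mem_closedBall_zero_iff, norm_smul, Real.norm_of_nonneg (by positivity)]
    refine mul_le_of_le_one_left (norm_nonneg _) ?_
    rw [div_le_one (by positivity)]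
    linarith [(Nat.cast_nonneg n : (0 : ℝ) ≤ n)]
  · intro m n hmn
    rw [Function.onFun, Set.disjoint_left]
    rintro _ ⟨_, rfl, x, hx, rfl⟩ ⟨_, rfl, x', hx', h⟩
    apply hmn
    have hxx : x - x' = (1 / ((n : ℝ) + 1) - 1 / ((m : ℝ) + 1)) • e := by
      rw [sub_smul, sub_eq_sub_iff_add_eq_add, add_comm x, add_comm _ x', add_comm x']
      exact h.symm
    have hle := hcl x hx x' hx'
    rw [hxx, inner_smul_left, conj_trivial, real_inner_self_eq_norm_sq, abs_mul, norm_smul,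
      Real.norm_eq_abs, abs_of_nonneg (sq_nonneg ‖e‖)] at hle
    set s := 1 / ((n : ℝ) + 1) - 1 / ((m : ℝ) + 1)
    have hs : s = 0 := by
      by_contra hs
      have hs' : 0 < |s| := abs_pos.2 hs
      have he : 0 < ‖e‖ := hc₀.trans_lt hc
      have h1 : 0 < |s| * ‖e‖ * (‖e‖ - c) := mul_pos (mul_pos hs' he) (sub_pos.2 hc)
      nlinarith
    have hs2 : (n : ℝ) + 1 = (m : ℝ) + 1 := by
      have : 1 / ((n : ℝ) + 1) = 1 / ((m : ℝ) + 1) := sub_eq_zero.1 hs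
      rw [one_div, one_div] at this
      exact inv_injective this
    have : (n : ℝ) = m := by linarith
    exact_mod_cast this.symm

/-- A monotone set-valued map is single-valued Lebesgue almost everywhere. -/
theorem volume_multivalued_eq_zero
    {G : Set (EuclideanSpace ℝ (Fin d) × EuclideanSpace ℝ (Fin d))}
    (hG : ∀ p ∈ G, ∀ p' ∈ G, 0 ≤ inner ℝ (p.1 - p'.1) (p.2 - p'.2)) :
    volume {x | ∃ y z, (x, y) ∈ G ∧ (x, z) ∈ G ∧ y ≠ z} = 0 := by
  obtain ⟨D, hD, hDd⟩ := TopologicalSpace.exists_countable_dense (EuclideanSpace ℝ (Fin d))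
  -- Points with one value near a.1 and another near a.2. Monotonicity between a value near a.1 over
  -- x and one near a.2 over x' bounds the chord x - x' along a.2 - a.1; the two errors of 1/8 add
  -- up to 1/4.
  let N : EuclideanSpace ℝ (Fin d) × EuclideanSpace ℝ (Fin d) → Set (EuclideanSpace ℝ (Fin d)) :=
    fun a => {x | a.1 ≠ a.2 ∧ ∃ y z, (x, y) ∈ G ∧ (x, z) ∈ G ∧ ‖y - a.1‖ < ‖a.2 - a.1‖ / 8 ∧
      ‖z - a.2‖ < ‖a.2 - a.1‖ / 8}
  have hnull : ∀ a, volume (N a) = 0 := by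
    rintro ⟨p, q⟩
    by_cases hpq : p = q
    · have : N (p, q) = ∅ := by
        ext x
        simp [N, hpq]
      rw [this, measure_empty]
    have hpos : 0 < ‖q - p‖ := norm_pos_iff.2 (sub_ne_zero.2 (Ne.symm hpq))
    refine volume_eq_zero_of_abs_inner_le (e := q - p) (c := ‖q - p‖ / 4) (by positivity)
      (by linarith) ?_
    have key : ∀ x ∈ N (p, q), ∀ x' ∈ N (p, q),
        inner ℝ (x - x') (q - p) ≤ ‖q - p‖ / 4 * ‖x - x'‖ := by
      rintro x ⟨-, y, z, hy, hz, hyp, hzq⟩ x' ⟨-, y', z', hy', hz', hyp', hzq'⟩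
      have h1 : 0 ≤ inner ℝ (x - x') (y - z') := hG _ hy _ hz'
      have h2 : q - p = (y - p) - (z' - q) - (y - z') := by abel
      rw [h2, inner_sub_right]
      have h3 : inner ℝ (x - x') ((y - p) - (z' - q)) ≤ ‖x - x'‖ * ‖(y - p) - (z' - q)‖ :=
        real_inner_le_norm _ _
      have h4 : ‖(y - p) - (z' - q)‖ ≤ ‖q - p‖ / 4 := by
        have := norm_sub_le (y - p) (z' - q)
        simp only at hyp hzq'
        linarith
      have h5 := mul_le_mul_of_nonneg_left h4 (norm_nonneg (x - x'))
      rw [← h2]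
      linarith
    intro x hx x' hx'
    rw [abs_le]
    refine ⟨?_, key x hx x' hx'⟩
    have := key x' hx' x hx
    rw [← neg_sub x x', inner_neg_left, norm_neg] at this
    linarith
  have hsub : {x | ∃ y z, (x, y) ∈ G ∧ (x, z) ∈ G ∧ y ≠ z} ⊆ ⋃ a ∈ D ×ˢ D, N a := by
    rintro x ⟨y, z, hy, hz, hyz⟩
    have hr : 0 < ‖y - z‖ := norm_pos_iff.2 (sub_ne_zero.2 hyz)
    -- With 1/16, ‖q - p‖ exceeds 7/8 of ‖y - z‖, and an eighth of that is still above 1/16.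
    obtain ⟨p, hp, hyp⟩ := hDd.exists_dist_lt y (ε := ‖y - z‖ / 16) (by positivity)
    obtain ⟨q, hq, hzq⟩ := hDd.exists_dist_lt z (ε := ‖y - z‖ / 16) (by positivity)
    rw [dist_eq_norm] at hyp hzq
    have hpq : ‖y - z‖ ≤ ‖y - p‖ + ‖z - q‖ + ‖q - p‖ := by
      have h : y - z = (y - p) - (z - q) - (q - p) := by abel
      calc ‖y - z‖ = ‖(y - p) - (z - q) - (q - p)‖ := by rw [← h]
        _ ≤ _ := (norm_sub_le _ _).trans (by gcongr; exact norm_sub_le _ _)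
    refine mem_biUnion (show (p, q) ∈ D ×ˢ D from ⟨hp, hq⟩) ⟨?_, y, z, hy, hz, ?_, ?_⟩
    · rintro h
      simp only at h
      rw [← h, sub_self, norm_zero] at hpq
      rw [← h] at hzq
      linarith
    · simp only; linarith
    · simp only; linarith
  exact measure_mono_null hsub ((measure_biUnion_null_iff (hD.prod hD)).2 fun a _ => hnull a)

theorem half_smul_add_self (σ : Measure (EuclideanSpace ℝ (Fin d))) :
    (2⁻¹ : ℝ≥0∞) • (σ + σ) = σ := by
  rw [← two_smul ℝ≥0∞ σ, smul_smul, ENNReal.inv_mul_cancel two_ne_zero ENNReal.ofNat_ne_top,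
    one_smul]

theorem average_mem_couplings {σ : Measure (EuclideanSpace ℝ (Fin d))}
    {πa πb : Measure (EuclideanSpace ℝ (Fin d) × EuclideanSpace ℝ (Fin d))}
    (ha : πa ∈ couplings σ μ) (hb : πb ∈ couplings σ ν) :
    (2⁻¹ : ℝ≥0∞) • (πa + πb) ∈ couplings σ ((2⁻¹ : ℝ≥0∞) • (μ + ν)) := by
  constructor
  · rw [Measure.map_smul, Measure.map_add _ _ measurable_fst, ha.1, hb.1, half_smul_add_self]
  · rw [Measure.map_smul, Measure.map_add _ _ measurable_snd, ha.2, hb.2]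

theorem average_mem_probMeasures (hμ : μ ∈ probMeasures M) (hν : ν ∈ probMeasures M) :
    (2⁻¹ : ℝ≥0∞) • (μ + ν) ∈ probMeasures M := by
  have := hμ.1
  have := hν.1
  refine ⟨⟨?_⟩, ?_⟩
  · rw [Measure.smul_apply, Measure.add_apply, measure_univ, measure_univ, one_add_one_eq_two,
      smul_eq_mul, ENNReal.inv_mul_cancel two_ne_zero ENNReal.ofNat_ne_top]
  · simp [hμ.2, hν.2]

/-- The average of optimal couplings with equal costs does not have a larger cost. -/
theorem exists_average_coupling (hM : IsCompact M) {σ : Measure (EuclideanSpace ℝ (Fin d))}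
    (hσ : σ ∈ probMeasures M) (hμ : μ ∈ probMeasures M) (hν : ν ∈ probMeasures M)
    (h : W₂ σ μ = W₂ σ ν) :
    ∃ πa ∈ couplings σ μ, ∃ πb ∈ couplings σ ν,
      ∫ p, ‖p.1 - p.2‖ ^ 2 ∂((2⁻¹ : ℝ≥0∞) • (πa + πb)) = W₂ σ μ ^ 2 ∧
      W₂ σ ((2⁻¹ : ℝ≥0∞) • (μ + ν)) ≤ W₂ σ μ := by
  obtain ⟨πa, ha, oa⟩ := exists_optimal_coupling hM hσ.1 hσ.2 hμ.1 hμ.2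
  obtain ⟨πb, hb, ob⟩ := exists_optimal_coupling hM hσ.1 hσ.2 hν.1 hν.2
  have := isProbabilityMeasure_of_mem_couplings hσ.1 ha
  have := isProbabilityMeasure_of_mem_couplings hσ.1 hb
  have hc := average_mem_couplings ha hb
  have hρ := average_mem_probMeasures hμ hν
  have hp := isProbabilityMeasure_of_mem_couplings hσ.1 hc
  have hcost : ∫ p, ‖p.1 - p.2‖ ^ 2 ∂((2⁻¹ : ℝ≥0∞) • (πa + πb)) = W₂ σ μ ^ 2 := by
    rw [integral_smul_measure, integral_add_measure
      (integrable_norm_sub_sq (memLp_two_of_map_mem hM hσ measurable_fst ha.1)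
        (memLp_two_of_map_mem hM hμ measurable_snd ha.2))
      (integrable_norm_sub_sq (memLp_two_of_map_mem hM hσ measurable_fst hb.1)
        (memLp_two_of_map_mem hM hν measurable_snd hb.2)), oa, ob, ← h]
    simp
    ring
  refine ⟨πa, ha, πb, hb, hcost, (sq_le_sq₀ (W₂_nonneg _ _) (W₂_nonneg _ _)).1 ?_⟩
  rw [← hcost]
  exact W₂_sq_le measurable_fst measurable_snd (memLp_two_of_map_mem hM hσ measurable_fst hc.1)
    (memLp_two_of_map_mem hM hρ measurable_snd hc.2) hc.1 hc.2

/-- An intermediate point between an absolutely continuous measure and another measure is determined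
by its distances to the two. -/
theorem eq_of_intermediate (hM : IsCompact M) (h₀ : μ₀ ∈ acMeasures M) (h₁ : μ₁ ∈ probMeasures M)
    (hμ : μ ∈ probMeasures M) (hν : ν ∈ probMeasures M) (e₀ : W₂ μ₀ μ = W₂ μ₀ ν)
    (e₁ : W₂ μ₁ μ = W₂ μ₁ ν) (hsum : W₂ μ₀ μ + W₂ μ₁ μ ≤ W₂ μ₀ μ₁) : μ = ν := by
  have h₀' := acMeasures_subset_probMeasures M h₀
  obtain ⟨πa, ha, πb, hb, hcost, hle₀⟩ := exists_average_coupling hM h₀' hμ hν e₀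
  obtain ⟨-, -, -, -, -, hle₁⟩ := exists_average_coupling hM h₁ hμ hν e₁
  have hρ := average_mem_probMeasures hμ hν
  have hc := average_mem_couplings ha hb
  set π := (2⁻¹ : ℝ≥0∞) • (πa + πb)
  -- The average is no farther from μ₀ and μ₁ than μ is, and `hsum` with the triangle inequality
  -- leaves no room to be closer.
  have hopt : ∫ p, ‖p.1 - p.2‖ ^ 2 ∂π = W₂ μ₀ ((2⁻¹ : ℝ≥0∞) • (μ + ν)) ^ 2 := by
    have := W₂_triangle hM hρ h₀' h₁
    rw [W₂_comm hM hρ h₀', W₂_comm hM hρ h₁] at this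
    rw [hcost, le_antisymm hle₀ (by linarith)]
  have hnull := volume_multivalued_eq_zero (G := π.support) fun p hp p' hp' =>
    monotone_support_of_optimal hM h₀' hρ hc hopt hp hp'
  have hsupp : πa π.supportᶜ = 0 ∧ πb π.supportᶜ = 0 := by
    have : π π.supportᶜ = 0 := Measure.measure_compl_support
    have h2 : (2⁻¹ : ℝ≥0∞) * (πa π.supportᶜ + πb π.supportᶜ) = 0 := this
    simpa using h2
  have := h₀.1
  -- Glued along μ₀, both second entries lie in the same almost everywhere single-valued support and
  -- hence agree. The third coupling is a dummy.
  obtain ⟨P, hP, ea, eb, -⟩ := exists_gluing ha.1 hb.1 hb.1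
  have ma : Measurable fun p : EuclideanSpace ℝ (Fin d) × EuclideanSpace ℝ (Fin d) ×
    EuclideanSpace ℝ (Fin d) × EuclideanSpace ℝ (Fin d) => (p.1, p.2.1) := by fun_prop
  have mb : Measurable fun p : EuclideanSpace ℝ (Fin d) × EuclideanSpace ℝ (Fin d) ×
    EuclideanSpace ℝ (Fin d) × EuclideanSpace ℝ (Fin d) => (p.1, p.2.2.1) := by fun_prop
  have lX : P.map (fun p => p.1) = μ₀ := by
    rw [← ha.1, ← ea, Measure.map_map measurable_fst ma]; rfl
  have la : P.map (fun p => p.2.1) = μ := by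
    rw [← ha.2, ← ea, Measure.map_map measurable_snd ma]; rfl
  have lb : P.map (fun p => p.2.2.1) = ν := by
    rw [← hb.2, ← eb, Measure.map_map measurable_snd mb]; rfl
  have aX : ∀ᵐ x ∂μ₀, ¬ ∃ y z, (x, y) ∈ π.support ∧ (x, z) ∈ π.support ∧ y ≠ z :=
    measure_eq_zero_iff_ae_notMem.1 (h₀.2.2 hnull)
  have aa : ∀ᵐ p ∂πa, p ∈ π.support := by
    simpa using measure_eq_zero_iff_ae_notMem.1 hsupp.1
  have ab : ∀ᵐ p ∂πb, p ∈ π.support := by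
    simpa using measure_eq_zero_iff_ae_notMem.1 hsupp.2
  rw [← lX] at aX
  rw [← ea] at aa
  rw [← eb] at ab
  rw [← la, ← lb]
  refine Measure.map_congr ?_
  filter_upwards [ae_of_ae_map measurable_fst.aemeasurable aX, ae_of_ae_map ma.aemeasurable aa,
    ae_of_ae_map mb.aemeasurable ab] with p h1 h2 h3
  by_contra hne
  exact h1 ⟨_, _, h2, h3, hne⟩

/-! ### Regression weights of collinear predictors -/

theorem vecMulVec_self_mul_mul {q : ℕ} (v : Fin q → ℝ) (A : Matrix (Fin q) (Fin q) ℝ) :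
    Matrix.vecMulVec v v * A * Matrix.vecMulVec v v = (v ⬝ᵥ (A *ᵥ v)) • Matrix.vecMulVec v v := by
  rw [Matrix.vecMulVec_mul, Matrix.vecMulVec_mul_vecMulVec, Matrix.dotProduct_mulVec,
    Matrix.vecMulVec_smul]

/-- For collinear predictors the weights are affine in the curve parameter, have total mass one, and
reproduce the parameter of the predictor value. -/
theorem globalWeight_of_collinear {q n : ℕ} {t : Fin n → ℝ} {b c : EuclideanSpace ℝ (Fin q)}
    {x : Fin n → EuclideanSpace ℝ (Fin q)} (hx : ∀ i, x i = t i • c + b)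
    (hne : ∃ i j, x i ≠ x j) (u : ℝ) :
    ∃ p r : ℝ, (∀ i, (n : ℝ)⁻¹ * globalWeight x i (u • c + b) = p + r * t i) ∧
      ∑ i, (p + r * t i) = 1 ∧ ∑ i, (p + r * t i) * t i = u := by
  obtain ⟨i₀, j₀, hij⟩ := hne
  have hn : (n : ℝ) ≠ 0 := by
    have := i₀.pos
    positivity
  have htij : t i₀ ≠ t j₀ := fun h => hij (by rw [hx, hx, h])
  have hc : c ≠ 0 := fun h => hij (by rw [hx, hx, h, smul_zero, smul_zero])
  set m : ℝ := (n : ℝ)⁻¹ * ∑ i, t i with hm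
  set V : ℝ := (n : ℝ)⁻¹ * ∑ i, (t i - m) ^ 2 with hV
  have hsum : ∑ i, t i = n * m := by rw [hm]; field_simp
  have hsumV : ∑ i, (t i - m) ^ 2 = n * V := by rw [hV]; field_simp
  have hV0 : V ≠ 0 := by
    intro h
    rw [h, mul_zero, Finset.sum_eq_zero_iff_of_nonneg fun i _ => sq_nonneg _] at hsumV
    have h1 := pow_eq_zero_iff two_ne_zero |>.1 (hsumV i₀ (Finset.mem_univ _))
    have h2 := pow_eq_zero_iff two_ne_zero |>.1 (hsumV j₀ (Finset.mem_univ _))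
    exact htij (by linarith)
  have hmean : sampleMean x = m • c + b := by
    simp only [sampleMean, hx, Finset.sum_add_distrib, ← Finset.sum_smul, hsum]
    simp only [Finset.sum_const, Finset.card_univ, Fintype.card_fin, smul_add, smul_smul,
      ← Nat.cast_smul_eq_nsmul ℝ]
    rw [inv_mul_cancel_left₀ hn, inv_mul_cancel₀ hn, one_smul]
  have hdiff : ∀ s : ℝ, s • c + b - sampleMean x = (s - m) • c := fun s => by
    rw [hmean, sub_smul]; abel
  have hcov : sampleCov x = V • Matrix.vecMulVec c.ofLp c.ofLp := by
    simp only [sampleCov, hx, hdiff, WithLp.ofLp_smul, Matrix.vecMulVec_smul, Matrix.smul_vecMulVec,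
      smul_smul, ← Finset.sum_smul, ← sq]
    rw [hV]
  set κ : ℝ := c.ofLp ⬝ᵥ (pinv (sampleCov x) *ᵥ c.ofLp) with hκ
  -- The covariance is V c cᵀ, so the first Penrose equation reads V²κ c cᵀ = V c cᵀ; a nonzero
  -- diagonal entry suffices.
  have hVκ : V * κ = 1 := by
    have h := (pinv_penrose (sampleCov_isHermitian x)).1
    generalize pinv (sampleCov x) = A at h hκ
    rw [hcov, Matrix.smul_mul, Matrix.smul_mul, Matrix.mul_smul, vecMulVec_self_mul_mul, ← hκ] at h
    obtain ⟨j, hj⟩ : ∃ j, c j ≠ 0 := by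
      by_contra! h0
      exact hc (by ext j; exact h0 j)
    have hjj := congrFun (congrFun h j) j
    simp only [Matrix.smul_apply, Matrix.vecMulVec_apply, smul_eq_mul] at hjj
    have hcc : V * (c j * c j) ≠ 0 := mul_ne_zero hV0 (mul_ne_zero hj hj)
    refine mul_right_cancel₀ hcc ?_
    linear_combination hjj
  have hw : ∀ i, globalWeight x i (u • c + b) = 1 + (t i - m) * (u - m) * κ := by
    intro i
    rw [globalWeight, hdiff, hx, hdiff, WithLp.ofLp_smul, WithLp.ofLp_smul, Matrix.mulVec_smul,
      dotProduct_smul, smul_dotProduct, ← hκ, smul_eq_mul, smul_eq_mul]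
    ring
  have h1 : ∑ i, (t i - m) = 0 := by
    rw [Finset.sum_sub_distrib, hsum]
    simp
  have h2 : ∑ i, (t i - m) * t i = n * V := by
    rw [← hsumV]
    have : ∀ i, (t i - m) * t i = (t i - m) ^ 2 + m * (t i - m) := fun i => by ring
    simp only [this]
    rw [Finset.sum_add_distrib, ← Finset.mul_sum, h1, mul_zero, add_zero]
  have hf : ∀ i, (n : ℝ)⁻¹ * (1 - m * (u - m) * κ) + (n : ℝ)⁻¹ * ((u - m) * κ) * t i
      = (n : ℝ)⁻¹ + (n : ℝ)⁻¹ * ((u - m) * κ) * (t i - m) := fun i => by ring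
  refine ⟨(n : ℝ)⁻¹ * (1 - m * (u - m) * κ), (n : ℝ)⁻¹ * ((u - m) * κ), fun i => ?_, ?_, ?_⟩
  · rw [hw]; ring
  · simp only [hf]
    rw [Finset.sum_add_distrib, ← Finset.mul_sum, h1]
    simp [hn]
  · simp only [hf, add_mul]
    simp only [mul_assoc]
    rw [Finset.sum_add_distrib]
    simp only [← Finset.mul_sum]
    rw [hsum, h2]
    field_simp
    linear_combination (u - m) * hVκ

/-! ### Concave functions under signed affine weights -/

/-- Without denominators the inequality also covers x = z. -/
theorem three_point_of_concaveOn {a b : ℝ} {k : ℝ → ℝ} (hk : ConcaveOn ℝ (Icc a b) k) {x y z : ℝ}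
    (hx : x ∈ Icc a b) (hz : z ∈ Icc a b) (hxy : x ≤ y) (hyz : y ≤ z) :
    (z - y) * k x + (y - x) * k z ≤ (z - x) * k y := by
  rcases (hxy.trans hyz).eq_or_lt with h | h
  · have h1 : y = x := by linarith
    subst h h1
    simp
  · have hpos : 0 < z - x := sub_pos.2 h
    have h₁ : 0 ≤ (z - y) / (z - x) := div_nonneg (by linarith) hpos.le
    have h₂ : 0 ≤ (y - x) / (z - x) := div_nonneg (by linarith) hpos.le
    have := hk.2 hx hz h₁ h₂ (by field_simp; ring)
    simp only [smul_eq_mul] at this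
    have e : (z - y) / (z - x) * x + (y - x) / (z - x) * z = y := by field_simp; ring
    rw [e] at this
    calc (z - y) * k x + (y - x) * k z
        = (z - x) * ((z - y) / (z - x) * k x + (y - x) / (z - x) * k z) := by field_simp
      _ ≤ _ := mul_le_mul_of_nonneg_left this hpos.le

/-- The chord of a concave function at the barycenter of an affine, possibly signed, weight is
at most the weighted sum of the function. -/
theorem chord_le_sum_of_concaveOn {ι : Type*} [Fintype ι] {a b u p r : ℝ} {k : ℝ → ℝ} {t : ι → ℝ}
    (hk : ConcaveOn ℝ (Icc a b) k) (ht : ∀ i, t i ∈ Icc a b) (hu : u ∈ Icc a b)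
    (h₁ : ∑ i, (p + r * t i) = 1) (h₂ : ∑ i, (p + r * t i) * t i = u) :
    (b - u) * k a + (u - a) * k b ≤ (b - a) * ∑ i, (p + r * t i) * k (t i) := by
  have key : ∀ {a b u p r : ℝ} {k : ℝ → ℝ} {t : ι → ℝ}, ConcaveOn ℝ (Icc a b) k →
      (∀ i, t i ∈ Icc a b) → u ∈ Icc a b → ∑ i, (p + r * t i) = 1 →
      ∑ i, (p + r * t i) * t i = u → r ≤ 0 →
      (b - u) * k a + (u - a) * k b ≤ (b - a) * ∑ i, (p + r * t i) * k (t i) := by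
    intro a b u p r k t hk ht hu h₁ h₂ hr
    have hab : a ≤ b := hu.1.trans hu.2
    have ha : a ∈ Icc a b := left_mem_Icc.2 hab
    have hb : b ∈ Icc a b := right_mem_Icc.2 hab
    -- Up to the factor b - a, this is k minus its chord: concave, nonnegative, zero at both ends.
    set m : ℝ → ℝ := fun s => (b - a) * k s - (b - s) * k a - (s - a) * k b with hm
    have hmnn : ∀ s ∈ Icc a b, 0 ≤ m s := fun s hs => by
      have := three_point_of_concaveOn hk ha hb hs.1 hs.2
      simp only [hm]
      linarith
    have hm3 : ∀ y ∈ Icc a b, ∀ z ∈ Icc a b, y ≤ z → (y - a) * m z ≤ (z - a) * m y := by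
      intro y hy z hz hyz
      have := mul_le_mul_of_nonneg_left (three_point_of_concaveOn hk ha hz hy.1 hyz)
        (sub_nonneg.2 hab)
      simp only [hm]
      linarith
    suffices h : 0 ≤ ∑ i, (p + r * t i) * m (t i) by
      have e : ∑ i, (p + r * t i) * m (t i) = (b - a) * ∑ i, (p + r * t i) * k (t i)
          - (b - u) * k a - (u - a) * k b := by
        have e1 : ∀ i, (p + r * t i) * m (t i) = (b - a) * ((p + r * t i) * k (t i))
          + (p + r * t i) * (a * k b - b * k a) + (p + r * t i) * t i * (k a - k b) := fun i => by
            simp only [hm]; ring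
        simp only [e1]
        rw [Finset.sum_add_distrib, Finset.sum_add_distrib, ← Finset.mul_sum, ← Finset.sum_mul,
          ← Finset.sum_mul, h₁, h₂]
        ring
      linarith
    by_cases hall : ∀ i, 0 ≤ p + r * t i
    · exact Finset.sum_nonneg fun i _ => mul_nonneg (hall i) (hmnn _ (ht i))
    push Not at hall
    obtain ⟨i₀, hi₀⟩ := hall
    obtain ⟨i₁, -, hi₁⟩ : ∃ i ∈ Finset.univ, 0 < p + r * t i :=
      Finset.exists_lt_of_sum_lt (f := fun _ => (0 : ℝ)) (by rw [h₁]; simp)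
    have hr' : r < 0 := by
      refine lt_of_le_of_ne hr fun h => ?_
      rw [h] at hi₀ hi₁
      linarith
    -- The zero of the weight, which is positive to the left of s and negative to the right.
    obtain ⟨s, hs⟩ : ∃ s, p = - r * s := ⟨-(p / r), by rw [neg_mul_neg, mul_div_cancel₀ _ hr'.ne]⟩
    have hw : ∀ i, p + r * t i = - r * (s - t i) := fun i => by rw [hs]; ring
    have hs₁ : t i₁ < s := by
      rw [hw] at hi₁
      nlinarith
    have hs₀ : s < t i₀ := by
      rw [hw] at hi₀
      nlinarith
    have hsmem : s ∈ Icc a b := ⟨(ht i₁).1.trans hs₁.le, hs₀.le.trans (ht i₀).2⟩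
    have hsa : 0 < s - a := sub_pos.2 ((ht i₁).1.trans_lt hs₁)
    -- The line through (a, 0) and (s, m s) lies below m before s and above it after s. The weight
    -- changes sign at s too, so replacing m by the line lowers every term.
    have hterm : ∀ i, (p + r * t i) * (t i - a) * m s ≤ (s - a) * ((p + r * t i) * m (t i)) := by
      intro i
      rw [hw]
      rcases le_total (t i) s with h | h
      · have := mul_le_mul_of_nonneg_left (hm3 _ (ht i) _ hsmem h)
          (mul_nonneg (neg_nonneg.2 hr) (sub_nonneg.2 h))
        linarith
      · have := mul_le_mul_of_nonneg_left (hm3 _ hsmem _ (ht i) h)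
          (mul_nonneg (neg_nonneg.2 hr) (sub_nonneg.2 h))
        linarith
    have hS := Finset.sum_le_sum fun i (_ : i ∈ Finset.univ) => hterm i
    rw [← Finset.mul_sum, ← Finset.sum_mul] at hS
    have e : ∑ i, (p + r * t i) * (t i - a) = u - a := by
      simp only [mul_sub]
      rw [Finset.sum_sub_distrib, ← Finset.sum_mul, h₁, h₂, one_mul]
    rw [e] at hS
    exact nonneg_of_mul_nonneg_right
      ((mul_nonneg (sub_nonneg.2 hu.1) (hmnn s hsmem)).trans hS) hsa
  rcases le_total r 0 with hr | hr
  · exact key hk ht hu h₁ h₂ hr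
  -- The reflection s ↦ -s reverses the sign of r.
  · have hk' : ConcaveOn ℝ (Icc (-b) (-a)) (fun s => k (-s)) := by
      refine ⟨convex_Icc _ _, fun x hx y hy α β hα hβ hαβ => ?_⟩
      have := hk.2 (x := -x) (y := -y) ⟨by linarith [hx.2], by linarith [hx.1]⟩
        ⟨by linarith [hy.2], by linarith [hy.1]⟩ hα hβ hαβ
      simpa [add_comm] using this
    have := key (u := -u) (p := p) (r := -r) (t := fun i => - t i) hk'
      (fun i => ⟨neg_le_neg (ht i).2, neg_le_neg (ht i).1⟩) ⟨neg_le_neg hu.2, neg_le_neg hu.1⟩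
      (by simpa using h₁) (by simp only [neg_mul, mul_neg, neg_neg, Finset.sum_neg_distrib, h₂])
      (by linarith)
    simp only [neg_neg, neg_mul_neg] at this
    linarith

/-! ### Recovery of the geodesic -/

/-- Along a geodesic, the squared distance to a fixed measure is `2 λ²`-concave, where `λ` is the
speed. -/
theorem concaveOn_W₂_sq_sub (hM : IsCompact M) {γ : ℝ → Measure (EuclideanSpace ℝ (Fin d))}
    {a b : ℝ} (hγ : IsGeodesicOn M γ a b) {μ : Measure (EuclideanSpace ℝ (Fin d))}
    (hμ : μ ∈ probMeasures M) (u : ℝ) :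
    ConcaveOn ℝ (Icc a b)
      (fun s => W₂ μ (γ s) ^ 2 - (s - u) ^ 2 * (W₂ (γ a) (γ b) / (b - a)) ^ 2) := by
  refine ⟨convex_Icc _ _, fun x hx y hy α β hα hβ hαβ => ?_⟩
  have hmem : ∀ s ∈ Icc a b, γ s ∈ probMeasures M := fun s hs =>
    acMeasures_subset_probMeasures M (hγ.1 s hs)
  have hz : α • x + β • y ∈ Icc a b := convex_Icc a b hx hy hα hβ hαβ
  obtain rfl : α = 1 - β := by linarith
  simp only [smul_eq_mul] at hz ⊢
  set z := (1 - β) * x + β * y with hzdef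
  have e₀ : |z - x| = β * |x - y| := by
    rw [show z - x = - (β * (x - y)) by rw [hzdef]; ring, abs_neg, abs_mul, abs_of_nonneg hβ]
  have e₁ : |z - y| = (1 - β) * |x - y| := by
    rw [show z - y = (1 - β) * (x - y) by rw [hzdef]; ring, abs_mul, abs_of_nonneg hα]
  have h := W₂_sq_comparison hM hμ (hmem z hz) (hmem x hx) (hmem y hy) hβ (by linarith)
    (hγ.2 x hx y hy) (by rw [hγ.2 z hz x hx, e₀]; ring) (by rw [hγ.2 z hz y hy, e₁]; ring)
  have e : (|x - y| / (b - a) * W₂ (γ a) (γ b)) ^ 2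
      = (x - y) ^ 2 * (W₂ (γ a) (γ b) / (b - a)) ^ 2 := by
    rw [← sq_abs (x - y)]; ring
  rw [e] at h
  -- The quadratic has exactly the convexity defect that the comparison inequality allows.
  have e2 : (z - u) ^ 2 = (1 - β) * (x - u) ^ 2 + β * (y - u) ^ 2 - β * (1 - β) * (x - y) ^ 2 := by
    rw [hzdef]; ring
  rw [e2]
  linarith

/-- Global Fréchet regression recovers a geodesic from collinear predictors. -/
theorem globalEstimate_eq_singleton (hM : IsCompact M)
    {γ : ℝ → Measure (EuclideanSpace ℝ (Fin d))} {a b : ℝ} (hab : a < b)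
    (hγ : IsGeodesicOn M γ a b) {q n : ℕ} {t : Fin n → ℝ} (ht : ∀ i, t i ∈ Icc a b)
    {ν : Fin n → Measure (EuclideanSpace ℝ (Fin d))} (hν : ∀ i, ν i = γ (t i))
    {v c : EuclideanSpace ℝ (Fin q)} {x : Fin n → EuclideanSpace ℝ (Fin q)}
    (hx : ∀ i, x i = t i • c + v) (hne : ∃ i j, x i ≠ x j) {u : ℝ} (hu : u ∈ Icc a b) :
    globalEstimate M x ν (u • c + v) = {γ u} := by
  obtain ⟨p, r, hw, h₁, h₂⟩ := globalWeight_of_collinear hx hne u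
  have ha : a ∈ Icc a b := left_mem_Icc.2 hab.le
  have hb : b ∈ Icc a b := right_mem_Icc.2 hab.le
  have hmem : ∀ s ∈ Icc a b, γ s ∈ probMeasures M := fun s hs =>
    acMeasures_subset_probMeasures M (hγ.1 s hs)
  have hD : 0 < b - a := sub_pos.2 hab
  set L := W₂ (γ a) (γ b) with hL
  have hL0 : 0 ≤ L := W₂_nonneg _ _
  have hobj : ∀ μ, globalObjective x ν (u • c + v) μ = ∑ i, (p + r * t i) * W₂ μ (γ (t i)) ^ 2 := by
    intro μ
    rw [globalObjective, Finset.mul_sum]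
    refine Finset.sum_congr rfl fun i _ => ?_
    rw [← mul_assoc, hw, hν]
  have hobju : globalObjective x ν (u • c + v) (γ u)
      = ∑ i, (p + r * t i) * ((t i - u) ^ 2 * (L / (b - a)) ^ 2) := by
    rw [hobj]
    refine Finset.sum_congr rfl fun i _ => ?_
    rw [hγ.2 u hu _ (ht i), ← sq_abs (t i - u), abs_sub_comm]
    ring
  -- The chord inequality times b - a, with its left side regrouped into a square and a triangle
  -- defect.
  have hgap : ∀ μ ∈ probMeasures M,
      ((b - u) * W₂ μ (γ a) - (u - a) * W₂ μ (γ b)) ^ 2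
        + (b - u) * (u - a) * ((W₂ μ (γ a) + W₂ μ (γ b)) ^ 2 - L ^ 2)
      ≤ (b - a) ^ 2 * (globalObjective x ν (u • c + v) μ
        - globalObjective x ν (u • c + v) (γ u)) := by
    intro μ hμ
    have h := mul_le_mul_of_nonneg_left
      (chord_le_sum_of_concaveOn (concaveOn_W₂_sq_sub hM hγ hμ u) ht hu h₁ h₂) hD.le
    rw [← hL] at h
    simp only [mul_sub (_ + _)] at h
    rw [Finset.sum_sub_distrib, ← hobj, ← hobju] at h
    refine le_trans (le_of_eq ?_) (h.trans_eq (by ring))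
    field_simp
    ring
  have htri : ∀ μ ∈ probMeasures M, 0 ≤ (W₂ μ (γ a) + W₂ μ (γ b)) ^ 2 - L ^ 2 := by
    intro μ hμ
    exact sub_nonneg.2 (pow_le_pow_left₀ hL0 (W₂_triangle hM hμ (hmem a ha) (hmem b hb)) 2)
  have hua : 0 ≤ (b - u) * (u - a) := mul_nonneg (sub_nonneg.2 hu.2) (sub_nonneg.2 hu.1)
  have hmin : ∀ μ ∈ probMeasures M, globalObjective x ν (u • c + v) (γ u) ≤
      globalObjective x ν (u • c + v) μ := by
    intro μ hμ
    refine sub_nonneg.1 (nonneg_of_mul_nonneg_right (le_trans ?_ (hgap μ hμ)) (pow_pos hD 2))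
    exact add_nonneg (sq_nonneg _) (mul_nonneg hua (htri μ hμ))
  refine Subset.antisymm (fun μ hμ => ?_) ?_
  · have hμM := acMeasures_subset_probMeasures M hμ.1
    have heq := le_antisymm (hμ.2 _ (hγ.1 u hu)) (hmin μ hμM)
    have hg := hgap μ hμM
    rw [heq, sub_self, mul_zero] at hg
    have hnn := mul_nonneg hua (htri μ hμM)
    have hA0 := W₂_nonneg μ (γ a)
    have hB0 := W₂_nonneg μ (γ b)
    have hcA := W₂_comm hM hμM (hmem a ha)
    have hcB := W₂_comm hM hμM (hmem b hb)
    have htab := W₂_triangle hM hμM (hmem a ha) (hmem b hb)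
    have htA := W₂_triangle hM (hmem b hb) hμM (hmem a ha)
    have htB := W₂_triangle hM (hmem a ha) hμM (hmem b hb)
    rw [W₂_comm hM (hmem b hb) (hmem a ha), ← hcB] at htA
    rw [← hcA] at htB
    rw [← hL] at htA htB
    have hlin : (b - u) * W₂ μ (γ a) = (u - a) * W₂ μ (γ b) := by
      refine sub_eq_zero.1 (pow_eq_zero_iff two_ne_zero |>.1 (le_antisymm ?_ (sq_nonneg _)))
      linarith
    have hprod : (b - u) * (u - a) * ((W₂ μ (γ a) + W₂ μ (γ b)) ^ 2 - L ^ 2) = 0 := by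
      refine le_antisymm ?_ hnn
      linarith [sq_nonneg ((b - u) * W₂ μ (γ a) - (u - a) * W₂ μ (γ b))]
    -- At u = a or u = b the product gives no information; there `hlin` makes one distance zero and
    -- `htA` or `htB` bounds the other by L.
    have hsum : W₂ μ (γ a) + W₂ μ (γ b) = L := by
      refine le_antisymm ?_ htab
      rcases mul_eq_zero.1 hprod with h | h
      · rcases mul_eq_zero.1 h with h | h
        · rw [h, zero_mul, show u - a = b - a by linarith] at hlin
          have : W₂ μ (γ b) = 0 := (mul_eq_zero.1 hlin.symm).resolve_left hD.ne'
          linarith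
        · rw [h, zero_mul, show b - u = b - a by linarith] at hlin
          have : W₂ μ (γ a) = 0 := (mul_eq_zero.1 hlin).resolve_left hD.ne'
          linarith
      · exact ((sq_eq_sq₀ (by positivity) hL0).1 (sub_eq_zero.1 h)).le
    have hA : W₂ μ (γ a) = (u - a) / (b - a) * L := by
      field_simp
      linear_combination hlin + (u - a) * hsum
    have hB : W₂ μ (γ b) = (b - u) / (b - a) * L := by
      field_simp
      linear_combination (b - u) * hsum - hlin
    refine eq_of_intermediate hM (hγ.1 a ha) (hmem b hb) hμM (hmem u hu) ?_ ?_ ?_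
    · rw [← hcA, hA, hγ.2 a ha u hu, abs_sub_comm, abs_of_nonneg (sub_nonneg.2 hu.1)]
    · rw [← hcB, hB, hγ.2 b hb u hu, abs_of_nonneg (sub_nonneg.2 hu.2)]
    · rw [← hcA, ← hcB, hsum]
  · rintro _ rfl
    exact ⟨hγ.1 u hu, fun μ hμ => hmin μ (acMeasures_subset_probMeasures M hμ)⟩

end FrechetRegression

theorem theorem1 {d q n : ℕ} (M : Set (EuclideanSpace ℝ (Fin d))) (hM : IsCompact M)
    (γ : ℝ → Measure (EuclideanSpace ℝ (Fin d))) (hγ : IsUniqueGeodesicOn M γ 0 1)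
    (t : Fin n → ℝ)
    (ν : Fin n → Measure (EuclideanSpace ℝ (Fin d))) (hν : ∀ i, ν i = γ (t i))
    (b c : EuclideanSpace ℝ (Fin q))
    (x : Fin n → EuclideanSpace ℝ (Fin q)) (hx : ∀ i, x i = t i • c + b)
    (hne : ∃ i j, x i ≠ x j) :
    ((∀ i, t i ∈ Icc (0 : ℝ) 1) →
      ∀ u ∈ Icc (0 : ℝ) 1, globalEstimate M x ν (u • c + b) = {γ u}) ∧
    (∀ s₁ s₂ : ℝ, s₁ ≤ 0 → 1 ≤ s₂ → IsUniqueGeodesicOn M γ s₁ s₂ → (∀ i, t i ∈ Icc s₁ s₂) →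
      ∀ u ∈ Icc s₁ s₂, globalEstimate M x ν (u • c + b) = {γ u}) :=
  ⟨fun ht _ hu => globalEstimate_eq_singleton hM one_pos hγ.1 ht hν hx hne hu,
    fun _ _ h₁ h₂ hγ' ht _ hu => globalEstimate_eq_singleton hM
      (h₁.trans_lt (one_pos.trans_le h₂)) hγ'.1 ht hν hx hne hu⟩
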